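/- **Definitions.** Let $\mathbb N=\{1,2,\dots\}$ and let $FIN(\mathbb N)$ be the monoid of finitely supported functions $\mathbb N\to\mathbb Z_{\ge 0}$ with the pointwise order and the unit vectors $\chi(\ell)$. A *label* is a hereditary (downward closed) subset $\mathcal M\subset FIN(\mathbb N)$; $\langle S\rangle$ denotes the smallest label containing $S$. The space of labels carries the ultrametric $d(\mathcal M_1,\mathcal M_2)=\inf\{2^{-N}: N\ge 0,\ \mathcal M_1\cap\mathcal B_N=\mathcal M_2\cap\mathcal B_N\}$, where $\mathcal B_0=\emptyset$ and, for $N\ge1$, $\mathcal B_N$ is the set of vectors with entries $\le N$ and support in $[1,N]$. A label is *of finite type* if it contains no infinite strictly increasing sequence. Put $\mathcal M-\mathbf r=\{\mathbf w\in FIN(\mathbb N):\mathbf w+\mathbf r\in\mathcal M\}$ and let $\Theta(\mathcal M)$ be the closure of $\{\mathcal M-\mathbf r:\mathbf r\in FIN(\mathbb N)\}$ in the space of labels. Fix an integer $b\ge 3$, an odd function $k:\mathbb Z\to\mathbb Z$ with $k(1)\ge b+1$ and $k(n+1)>b\sum_{i=0}^n k(i)$ for all $n\ge 0$, and a partition of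 $\mathbb N$ into infinite sets $D_1,D_2,\dots$ with $\min D_\ell<\min D_{\ell+1}$. Let $A[\mathcal M]\subset\mathbb Z$ be the set of all $t=k(j_1)+\dots+k(j_r)$ with $r\ge0$, $j_i\in\mathbb Z\setminus\{0\}$, $|j_1|>\dots>|j_r|$, whose length vector $\mathbf r(t)$, $\mathbf r(t)_\ell=\#\{i:|j_i|\in D_\ell\}$, lies in $\mathcal M$. Let $X(\mathcal M)\subset\{0,1\}^{\mathbb Z}$ be the orbit closure of the characteristic function of $A[\mathcal M]$ under the shift $(Sx)_t=x_{t+1}$. For a homeomorphism $T$ of a compact metric space $X$, a point $x$ is *recurrent* if $x=\lim_i T^{n_i}x$ or $x=\lim_i T^{-n_i}x$ for some strictly increasing sequence of positive integers $n_i$; $(X,T)$ is *CT* (center trivial) if it has exactly one recurrent point; it is *topologically transitive* if for all nonempty open $U,V\subset X$ there is $n\in\mathbb Z$ with $T^{-n}U\cap V\ne\emptyset$; $x$ is an *equicontinuity point* if $\{T^n:n\in\mathbb Z\}$ is equicontinuous at $x$; $(X,T)$ is *AE* if its equicontinuity points are dense, *HAE* if every subsystem (nonempty closed $Z\subset X$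 with $T(Z)=Z$) is AE, and *LE* if every $x\in X$ is an equicontinuity point of its orbit closure. **Theorem.** 1. There are labels of finite type with $\Theta(\mathcal M)$ uncountable. Specifically, both of the following labels are of finite type and have uncountable $\Theta(\mathcal M)$: (a) for any bijection $w\mapsto\ell_w$ from the finite words in $\{0,1\}$ onto $\mathbb N$, the label $\mathcal M=\bigcup_{x\in\{0,1\}^{\mathbb N}}\langle\{\chi(\ell)+\chi(\ell'):\ell,\ell'\in M_x\}\rangle$, where $M_x=\{\ell_{x_1\cdots x_n}:n\ge1\}$; (b) for any partition $\mathbb N=L\sqcup B$ into infinite sets and any bijection $A\mapsto\ell_A$ from the finite subsets of $L$ onto $B$, the label $\mathcal M=\langle\{\chi(\ell_A)+\chi(i): A\subset L \text{ finite},\ i\in A\}\rangle$. 2. For every label $\mathcal M$ of finite type with $\Theta(\mathcal M)$ uncountable, $X(\mathcal M)$ is an uncountable, topologically transitive CT subshift. Its unique recurrent point is the zero sequence $e$, every point of $X(\mathcal M)$ is isolated in its orbit closure, and $(X(\mathcal M),S)$ is LE but not HAE. -/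

import Mathlib

open Filter Topology

noncomputable section

/-! ### Topological dynamics of a homeomorphism

A system `(Y, T)` is given by a homeomorphism `T` of an ambient space and a closed set `Y` with
`T '' Y = Y`; the group element `T ^ n`, for `n : ℤ`, is the `n`-th iterate of `T`. -/

/-- `Y` is (the phase space of) a subsystem: nonempty, closed and invariant. -/
def IsSubsystem {X : Type*} [TopologicalSpace X] (T : X ≃ₜ X) (Y : Set X) : Prop :=
  Y.Nonempty ∧ IsClosed Y ∧ T '' Y = Y

/-- The orbit closure of `x`. -/
def orbitClosure {X : Type*} [TopologicalSpace X] (T : X ≃ₜ X) (x : X) : Set X :=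
  closure (Set.range fun n : ℤ => (T ^ n) x)

/-- `(Y, T)` is topologically transitive: for nonempty relatively open subsets `U ∩ Y`, `V ∩ Y`
of `Y` there is `n ∈ ℤ` such that `T⁻ⁿ (U ∩ Y)` meets `V ∩ Y`. -/
def IsTopTransitive {X : Type*} [TopologicalSpace X] (T : X ≃ₜ X) (Y : Set X) : Prop :=
  ∀ U V : Set X, IsOpen U → IsOpen V → (U ∩ Y).Nonempty → (V ∩ Y).Nonempty →
    ∃ n : ℤ, (((T ^ n) ⁻¹' (U ∩ Y)) ∩ (V ∩ Y)).Nonempty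

/-- The limit set `R_T(x) = ω_T(x) ∪ α_T(x)`: limits of `T^{n_i} x` or of `T^{-n_i} x` along
strictly increasing sequences `n_i` of natural numbers. -/
def limitSet {X : Type*} [TopologicalSpace X] (T : X ≃ₜ X) (x : X) : Set X :=
  {y | ∃ n : ℕ → ℕ, StrictMono n ∧ Tendsto (fun i => (T ^ (n i : ℤ)) x) atTop (𝓝 y)} ∪
  {y | ∃ n : ℕ → ℕ, StrictMono n ∧ Tendsto (fun i => (T ^ (-(n i : ℤ))) x) atTop (𝓝 y)}

/-- A point is recurrent when it belongs to its own limit set. -/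
def IsRecurrentPt {X : Type*} [TopologicalSpace X] (T : X ≃ₜ X) (x : X) : Prop :=
  x ∈ limitSet T x

/-- `(Y, T)` is center trivial (CT): it has exactly one recurrent point. -/
def IsCenterTrivial {X : Type*} [TopologicalSpace X] (T : X ≃ₜ X) (Y : Set X) : Prop :=
  ∃! e : X, e ∈ Y ∧ IsRecurrentPt T e

/-- `x` is an isolated point of `Y` in the relative topology. -/
def IsIsolatedIn {X : Type*} [TopologicalSpace X] (Y : Set X) (x : X) : Prop :=
  ∃ U : Set X, IsOpen U ∧ U ∩ Y = {x}

/-- `x` is an equicontinuity point of `(Y, T)`: the family `{Tⁿ | Y : n ∈ ℤ}` is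
equicontinuous at `x`. -/
def IsEquicontinuityPt {X : Type*} [UniformSpace X] (T : X ≃ₜ X) (Y : Set X) (x : X) : Prop :=
  x ∈ Y ∧ EquicontinuousWithinAt (fun (n : ℤ) (y : X) => (T ^ n) y) Y x

/-- `(Y, T)` is almost equicontinuous (AE): its equicontinuity points are dense in `Y`. -/
def IsAE {X : Type*} [UniformSpace X] (T : X ≃ₜ X) (Y : Set X) : Prop :=
  Y ⊆ closure {x | IsEquicontinuityPt T Y x}

/-- `(Y, T)` is hereditarily almost equicontinuous (HAE): every subsystem is AE. -/
def IsHAE {X : Type*} [UniformSpace X] (T : X ≃ₜ X) (Y : Set X) : Prop :=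
  ∀ Z : Set X, Z ⊆ Y → IsSubsystem T Z → IsAE T Z

/-- `(Y, T)` is locally equicontinuous (LE): every point of `Y` is an equicontinuity point of
its orbit closure. -/
def IsLE {X : Type*} [UniformSpace X] (T : X ≃ₜ X) (Y : Set X) : Prop :=
  ∀ x ∈ Y, IsEquicontinuityPt T (orbitClosure T x) x

/-- The shift `(S x)_t = x_{t + 1}` on `{0,1}^ℤ` (with the product topology and uniformity). -/
def binaryShift : (ℤ → Bool) ≃ₜ (ℤ → Bool) where
  toFun x t := x (t + 1)
  invFun x t := x (t - 1)
  left_inv x := by funext t; simp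
  right_inv x := by funext t; simp
  continuous_toFun := by fun_prop
  continuous_invFun := by fun_prop

/-! ### Labels -/

/-- `FIN(ℕ)`: finitely supported vectors of nonnegative integers indexed by the positive
integers, with the pointwise order and addition. -/
abbrev NVec : Type := ℕ+ →₀ ℕ

/-- The unit vector `χ(ℓ)`. -/
def unitVec (l : ℕ+) : NVec := Finsupp.single l 1

/-- A label: a hereditary set of `ℕ`-vectors. -/
@[ext]
structure NLabel where
  carrier : Set NVec
  hereditary : ∀ {m m₁ : NVec}, m₁ ≤ m → m ∈ carrier → m₁ ∈ carrier

/-- The sets `𝓑_N` of vectors with entries at most `N` and support in `[1, N]`, with the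
convention `𝓑_0 = ∅`. -/
def boxSet (N : ℕ) : Set NVec :=
  {m | 0 < N ∧ (∀ l, m l ≤ N) ∧ ∀ l ∈ m.support, (l : ℕ) ≤ N}

namespace NLabel

/-- The label `⟨S⟩` generated by a set `S` of `ℕ`-vectors. -/
def generate (S : Set NVec) : NLabel where
  carrier := {m | ∃ v ∈ S, m ≤ v}
  hereditary := by
    rintro m m₁ h ⟨v, hv, hm⟩
    exact ⟨v, hv, h.trans hm⟩

/-- The label `M - r = {w : w + r ∈ M}`. -/
def sub (M : NLabel) (r : NVec) : NLabel where
  carrier := {w | w + r ∈ M.carrier}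
  hereditary := by
    intro m m₁ h hm
    exact M.hereditary (by gcongr) hm

/-- Finite type (finite chain condition): there is no infinite strictly increasing sequence
in `M`. -/
def IsFiniteType (M : NLabel) : Prop :=
  ¬ ∃ f : ℕ → NVec, StrictMono f ∧ ∀ n, f n ∈ M.carrier

/-- The numbers `2^{-N}` such that `M₁ ∩ 𝓑_N = M₂ ∩ 𝓑_N`. -/
def distSet (M₁ M₂ : NLabel) : Set ℝ :=
  {ε | ∃ N : ℕ, ε = (1 / 2 : ℝ) ^ N ∧ M₁.carrier ∩ boxSet N = M₂.carrier ∩ boxSet N}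

/-- The ultrametric `d(M₁, M₂) = inf {2^{-N} : M₁ ∩ 𝓑_N = M₂ ∩ 𝓑_N}` on labels. -/
instance : Dist NLabel := ⟨fun M₁ M₂ => sInf (distSet M₁ M₂)⟩

end NLabel

theorem boxSet_mono {N N' : ℕ} (h : N ≤ N') : boxSet N ⊆ boxSet N' := by
  rintro m ⟨h0, h1, h2⟩
  exact ⟨h0.trans_le h, fun l => (h1 l).trans h, fun l hl => (h2 l hl).trans h⟩

theorem exists_mem_boxSet (m : NVec) : ∃ N, m ∈ boxSet N := by
  refine ⟨1 + (∑ l ∈ m.support, m l) + ∑ l ∈ m.support, (l : ℕ), by omega, fun l => ?_,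
    fun l hl => ?_⟩
  · by_cases hl : l ∈ m.support
    · have := Finset.single_le_sum (f := fun l => m l) (fun _ _ => Nat.zero_le _) hl
      omega
    · have : m l = 0 := by simpa using hl
      omega
  · have := Finset.single_le_sum (f := fun l : ℕ+ => (l : ℕ)) (fun _ _ => Nat.zero_le _) hl
    omega

namespace NLabel

theorem inter_boxSet_mono {M₁ M₂ : NLabel} {N N' : ℕ} (h : N ≤ N')
    (hN : M₁.carrier ∩ boxSet N' = M₂.carrier ∩ boxSet N') :
    M₁.carrier ∩ boxSet N = M₂.carrier ∩ boxSet N := by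
  rw [← Set.inter_eq_self_of_subset_right (boxSet_mono h), ← Set.inter_assoc, hN,
    Set.inter_assoc]

theorem distSet_bddBelow (M₁ M₂ : NLabel) : BddBelow (distSet M₁ M₂) := by
  refine ⟨0, ?_⟩
  rintro _ ⟨N, rfl, -⟩
  positivity

theorem distSet_nonempty (M₁ M₂ : NLabel) : (distSet M₁ M₂).Nonempty :=
  ⟨(1 / 2 : ℝ) ^ 0, 0, rfl, by simp [boxSet]⟩

/-- Metric balls of radius `2^{-N}` are the sets of labels that agree on `𝓑_{N+1}`. -/
theorem dist_lt_iff (M₁ M₂ : NLabel) (N : ℕ) :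
    dist M₁ M₂ < (1 / 2 : ℝ) ^ N ↔
      M₁.carrier ∩ boxSet (N + 1) = M₂.carrier ∩ boxSet (N + 1) := by
  constructor
  · intro h
    obtain ⟨_, ⟨K, rfl, hK⟩, hlt⟩ := exists_lt_of_csInf_lt (distSet_nonempty M₁ M₂) h
    have : N < K := (pow_lt_pow_iff_right_of_lt_one₀ (by norm_num) (by norm_num)).1 hlt
    exact inter_boxSet_mono this hK
  · intro h
    refine (csInf_le (distSet_bddBelow M₁ M₂) ⟨N + 1, rfl, h⟩).trans_lt ?_
    exact pow_lt_pow_right_of_lt_one₀ (by norm_num) (by norm_num) (Nat.lt_succ_self N)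

theorem dist_nonneg' (M₁ M₂ : NLabel) : 0 ≤ dist M₁ M₂ := by
  refine le_csInf (distSet_nonempty M₁ M₂) ?_
  rintro _ ⟨N, rfl, -⟩
  positivity

theorem dist_triangle' (M₁ M₂ M₃ : NLabel) : dist M₁ M₃ ≤ dist M₁ M₂ + dist M₂ M₃ := by
  refine le_of_forall_pos_le_add fun δ hδ => ?_
  obtain ⟨_, ⟨K, rfl, hK⟩, hlt⟩ :=
    exists_lt_of_csInf_lt (distSet_nonempty M₁ M₂)
      (show sInf (distSet M₁ M₂) < dist M₁ M₂ + δ from lt_add_of_pos_right _ hδ)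
  obtain ⟨_, ⟨L, rfl, hL⟩, hlt'⟩ :=
    exists_lt_of_csInf_lt (distSet_nonempty M₂ M₃)
      (show sInf (distSet M₂ M₃) < dist M₂ M₃ + δ from lt_add_of_pos_right _ hδ)
  have h12 := dist_nonneg' M₁ M₂
  have h23 := dist_nonneg' M₂ M₃
  rcases le_total K L with h | h
  · have := csInf_le (distSet_bddBelow M₁ M₃) ⟨K, rfl, hK.trans (inter_boxSet_mono h hL)⟩
    change dist M₁ M₃ ≤ _ at this
    linarith
  · have := csInf_le (distSet_bddBelow M₁ M₃) ⟨L, rfl, (inter_boxSet_mono h hK).trans hL⟩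
    change dist M₁ M₃ ≤ _ at this
    linarith

theorem dist_self' (M : NLabel) : dist M M = 0 := by
  refine le_antisymm (le_of_forall_pos_lt_add fun δ hδ => ?_) (dist_nonneg' M M)
  obtain ⟨N, hN⟩ := exists_pow_lt_of_lt_one hδ (show (1 / 2 : ℝ) < 1 by norm_num)
  rw [zero_add]
  exact ((dist_lt_iff M M N).2 rfl).trans hN

theorem eq_of_dist_eq_zero' {M₁ M₂ : NLabel} (h : dist M₁ M₂ = 0) : M₁ = M₂ := by
  have key : ∀ N, M₁.carrier ∩ boxSet (N + 1) = M₂.carrier ∩ boxSet (N + 1) := fun N =>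
    (dist_lt_iff M₁ M₂ N).1 (by rw [h]; positivity)
  ext m
  obtain ⟨N, hN⟩ := exists_mem_boxSet m
  have hm := boxSet_mono (Nat.le_succ N) hN
  have := congrArg (m ∈ ·) (key N)
  simpa [hm] using this

/-- The space of labels as a metric space. -/
instance : MetricSpace NLabel where
  dist_self := dist_self'
  dist_comm M₁ M₂ := by
    change sInf (distSet M₁ M₂) = sInf (distSet M₂ M₁)
    congr 1
    ext ε
    exact ⟨fun ⟨N, h, h'⟩ => ⟨N, h, h'.symm⟩, fun ⟨N, h, h'⟩ => ⟨N, h, h'.symm⟩⟩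
  dist_triangle := dist_triangle'
  eq_of_dist_eq_zero := eq_of_dist_eq_zero'

/-- `Θ(M)`: the closure of `{M - r : r ∈ FIN(ℕ)}` in the space of labels. -/
def Theta (M : NLabel) : Set NLabel :=
  closure (Set.range fun r : NVec => M.sub r)

end NLabel

/-! ### Expansion systems and labeled subshifts -/

/-- The data fixed throughout: an integer `b ≥ 3`, a `b`-expanding function `k` with
`k(1) ≥ b + 1`, and a partition of the positive integers into infinite sets `D_1, D_2, …`
numbered so that `min D_ℓ < min D_{ℓ+1}`. -/
structure ExpansionSystem where
  b : ℕ
  three_le_b : 3 ≤ b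
  k : ℤ → ℤ
  k_odd : ∀ n : ℤ, k (-n) = -k n
  k_expanding : ∀ n : ℕ, (b : ℤ) * ∑ i ∈ Finset.range (n + 1), k (i : ℤ) < k ((n : ℤ) + 1)
  k_one : (b : ℤ) + 1 ≤ k 1
  D : ℕ+ → Set ℕ+
  D_infinite : ∀ l, (D l).Infinite
  D_disjoint : ∀ l l', l ≠ l' → Disjoint (D l) (D l')
  D_cover : ∀ n, ∃ l, n ∈ D l
  D_ordered : ∀ l a c, IsLeast (D l) a → IsLeast (D (l + 1)) c → a < c

namespace ExpansionSystem

variable (E : ExpansionSystem)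

/-- The support map `n ↦ ℓ(n)`, where `n ∈ D_{ℓ(n)}`. -/
def ell (n : ℕ+) : ℕ+ := (E.D_cover n).choose

/-- `j_1, …, j_r` is an expansion of `t`: the `j_i` are nonzero integers with
`|j_1| > … > |j_r|` and `t = k(j_1) + … + k(j_r)`. -/
def IsExpansion (js : List ℤ) (t : ℤ) : Prop :=
  (∀ j ∈ js, j ≠ 0) ∧ js.Pairwise (fun i j => |j| < |i|) ∧ t = (js.map E.k).sum

/-- The length vector `χ(ℓ(|j_1|)) + … + χ(ℓ(|j_r|))` of `j_1, …, j_r` (all nonzero). -/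
def lengthVec (js : List ℤ) : NVec :=
  (js.map fun j => unitVec (E.ell j.natAbs.toPNat')).sum

/-- `A[M]`: the integers that have an expansion with length vector in `M`. -/
def timeSet (M : NLabel) : Set ℤ :=
  {t | ∃ js : List ℤ, E.IsExpansion js t ∧ E.lengthVec js ∈ M.carrier}

open Classical in
/-- `x[M]`: the characteristic function of `A[M]`. -/
def point (M : NLabel) : ℤ → Bool := fun t => decide (t ∈ E.timeSet M)

/-- `X(M)`: the orbit closure of `x[M]` under the shift. -/
def subshift (M : NLabel) : Set (ℤ → Bool) := orbitClosure binaryShift (E.point M)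

end ExpansionSystem

/-! ### Two explicit families of labels -/

/-- The set `M_x = {ℓ_w : w a nonempty initial word of x}`, for a sequence `x` of zeros and ones
and a numbering `w ↦ ℓ_w` of the finite words. -/
def branchSet (num : List Bool ≃ ℕ+) (x : ℕ → Bool) : Set ℕ+ :=
  {l | ∃ n : ℕ, 0 < n ∧ l = num ((List.range n).map x)}

/-- The label `⋃_x ⟨χ(ℓ) + χ(ℓ') : ℓ, ℓ' ∈ M_x⟩`. -/
def branchLabel (num : List Bool ≃ ℕ+) : NLabel :=
  NLabel.generate {v | ∃ x : ℕ → Bool, ∃ l ∈ branchSet num x, ∃ l' ∈ branchSet num x,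
    v = unitVec l + unitVec l'}

/-- The label `⟨χ(ℓ_A) + χ(i) : A a finite subset of L, i ∈ A⟩`, for a map `A ↦ ℓ_A`. -/
def finsetLabel (L : Set ℕ+) (num : Finset ℕ+ → ℕ+) : NLabel :=
  NLabel.generate {v | ∃ A : Finset ℕ+, (A : Set ℕ+) ⊆ L ∧ ∃ i ∈ A,
    v = unitVec (num A) + unitVec i}

end

open Filter Topology

noncomputable section

/-! ### Expansions as finitely supported coefficient functions -/

/-! Expansions are encoded as sign vectors `c` with value `∑ c_j k(j)`. Since `k(m)` exceeds three
times the sum of the earlier terms, the top term dominates every combination with coefficients at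
most 3. So expansions are unique, and a combination with coefficients at most 2 and small value has
no large index. Consequently, if all indices of `t` exceed `|u|`, then `u + t ∈ A[M]` iff `u ∈ A[M -
r(t)]` (`add_value_mem_timeSet`).

This relates shifts to labels. Shifting `x[M]` by times with length vector `r` and indices tending
to infinity gives `x[M - r]` in the limit. Hence `x[·]`, continuous and injective, embeds `Θ(M)` in
`X(M)`, which is therefore uncountable. Conversely, for `M` of finite type every nonzero point of
`X(M)` is a shift of some `x[N]` with `0 ∈ N ⊆ M` (`exists_limit`): along an ultrafilter the
coefficients of the times stabilise to a finite part, and the remainders escape to infinity.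

Such an `N` has a maximal vector `w`. If `c` has length vector `w`, the symbols of `x[N]` at `0` and
`± value c` determine a neighbourhood to which no nontrivial shift of `x[N]` returns
(`exists_isOpen_return`). This gives isolation in orbit closures, local equicontinuity and absence
of nonzero recurrent points. HAE fails because an uncountable subshift contains a perfect subsystem,
whereas expansivity makes equicontinuity points isolated.

Both explicit labels have vectors of degree at most 2, hence finite type. Limits of `M - χ(ℓ)`,
along the initial words of a sequence or along finite sets exhausting a subset of `L`, recover that
sequence or subset, so `Θ` is uncountable. -/

/-- Coefficient functions with values in `{-1, 0, 1}`. -/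
def IsSignVec (c : ℕ+ →₀ ℤ) : Prop := ∀ j, |c j| ≤ 1

theorem IsSignVec.zero : IsSignVec 0 := fun j => by simp

theorem IsSignVec.neg {c : ℕ+ →₀ ℤ} (h : IsSignVec c) : IsSignVec (-c) := fun j => by
  simpa using h j

theorem IsSignVec.add {c d : ℕ+ →₀ ℤ} (hc : IsSignVec c) (hd : IsSignVec d)
    (h : ∀ j, c j = 0 ∨ d j = 0) : IsSignVec (c + d) := fun j => by
  rcases h j with h | h
  · simpa [h] using hd j
  · simpa [h] using hc j

namespace ExpansionSystem

variable (E : ExpansionSystem)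

theorem k_zero : E.k 0 = 0 := by
  have := E.k_odd 0
  simp at this
  omega

theorem one_le_k (n : ℕ) (hn : 0 < n) : 1 ≤ E.k n := by
  induction n using Nat.strong_induction_on with
  | _ n ih =>
    obtain ⟨m, rfl⟩ : ∃ m, n = m + 1 := ⟨n - 1, by omega⟩
    have h := E.k_expanding m
    have h0 : 0 ≤ ∑ i ∈ Finset.range (m + 1), E.k (i : ℤ) := by
      refine Finset.sum_nonneg fun i hi => ?_
      rcases Nat.eq_zero_or_pos i with rfl | hi0
      · simp [E.k_zero]
      · have := ih i (by simpa using hi) hi0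
        omega
    have h1 : (0 : ℤ) ≤ (E.b : ℤ) * ∑ i ∈ Finset.range (m + 1), E.k (i : ℤ) :=
      mul_nonneg (by positivity) h0
    push_cast
    omega

theorem k_nonneg (n : ℕ) : 0 ≤ E.k n := by
  rcases Nat.eq_zero_or_pos n with rfl | hn
  · simp [E.k_zero]
  · have := E.one_le_k n hn
    omega

theorem sum_k_nonneg (m : ℕ) : 0 ≤ ∑ i ∈ Finset.range m, E.k (i : ℤ) :=
  Finset.sum_nonneg fun i _ => E.k_nonneg i

theorem three_mul_sum_lt (m : ℕ) (hm : 0 < m) :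
    3 * ∑ i ∈ Finset.range m, E.k (i : ℤ) < E.k m := by
  obtain ⟨n, rfl⟩ : ∃ n, m = n + 1 := ⟨m - 1, by omega⟩
  have h := E.k_expanding n
  have h0 := E.sum_k_nonneg (n + 1)
  have hb : (3 : ℤ) ≤ E.b := by exact_mod_cast E.three_le_b
  push_cast
  nlinarith

/-- Converts a bound on values into a bound on indices in `eq_zero_of_abs_value_le`. -/
theorem le_sum_k (m : ℕ) : (m : ℤ) ≤ ∑ i ∈ Finset.range (m + 1), E.k (i : ℤ) := by
  induction m with
  | zero => simp [E.k_zero]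
  | succ m ih =>
    rw [Finset.sum_range_succ]
    have := E.one_le_k (m + 1) (by omega)
    push_cast at this ⊢
    omega

/-- The integer `∑ c_j k(j)`. -/
def value : (ℕ+ →₀ ℤ) →ₗ[ℤ] ℤ := Finsupp.linearCombination ℤ fun j : ℕ+ => E.k (j : ℕ)

theorem value_single (j : ℕ+) (a : ℤ) : E.value (Finsupp.single j a) = a * E.k (j : ℕ) := by
  simp [value]

/-- The vector `∑ |c_j| χ(ℓ(j))`. -/
def lengthOf (c : ℕ+ →₀ ℤ) : NVec := c.sum fun j a => a.natAbs • unitVec (E.ell j)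

theorem lengthOf_single (j : ℕ+) (a : ℤ) :
    E.lengthOf (Finsupp.single j a) = a.natAbs • unitVec (E.ell j) := by
  simp [lengthOf]

theorem lengthOf_zero : E.lengthOf 0 = 0 := by simp [lengthOf]

theorem lengthOf_neg (c : ℕ+ →₀ ℤ) : E.lengthOf (-c) = E.lengthOf c := by
  rw [lengthOf, Finsupp.sum_neg_index (by simp)]
  simp [lengthOf]

theorem lengthOf_add {c d : ℕ+ →₀ ℤ} (h : ∀ j, c j = 0 ∨ d j = 0) :
    E.lengthOf (c + d) = E.lengthOf c + E.lengthOf d := by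
  refine Finsupp.sum_add_index_of_disjoint (Finset.disjoint_left.2 fun j hc hd => ?_) _
  rw [Finsupp.mem_support_iff] at hc hd
  exact (h j).elim hc hd

theorem eq_zero_of_lengthOf_eq_zero {c : ℕ+ →₀ ℤ} (h : E.lengthOf c = 0) : c = 0 := by
  by_contra hc
  obtain ⟨j, hj⟩ := Finsupp.support_nonempty_iff.2 hc
  have := Finset.single_le_sum (f := fun j => (c j).natAbs • unitVec (E.ell j))
    (fun _ _ => zero_le) hj
  change _ ≤ E.lengthOf c at this
  rw [h] at this
  have := this (E.ell j)
  simp [unitVec] at this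
  simp [this] at hj

theorem abs_value_le {B : ℕ} {f : ℕ+ →₀ ℤ} {m : ℕ+} (hB : ∀ j, |f j| ≤ B)
    (hf : ∀ j ∈ f.support, j < m) :
    |E.value f| ≤ B * ∑ i ∈ Finset.range m, E.k (i : ℤ) := by
  calc |E.value f| ≤ ∑ j ∈ f.support, |f j • E.k (j : ℕ)| := by
        rw [value, Finsupp.linearCombination_apply]
        exact Finset.abs_sum_le_sum_abs _ _
    _ ≤ ∑ j ∈ f.support, (B : ℤ) * E.k (j : ℕ) := by
        refine Finset.sum_le_sum fun j _ => ?_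
        rw [smul_eq_mul, abs_mul, abs_of_nonneg (E.k_nonneg j)]
        exact mul_le_mul_of_nonneg_right (hB j) (E.k_nonneg j)
    _ = B * ∑ i ∈ f.support.image (fun j : ℕ+ => (j : ℕ)), E.k (i : ℤ) := by
        rw [Finset.sum_image (fun _ _ _ _ h => PNat.coe_injective h), Finset.mul_sum]
    _ ≤ _ := by
        refine mul_le_mul_of_nonneg_left ?_ (by positivity)
        refine Finset.sum_le_sum_of_subset_of_nonneg (fun i hi => ?_) fun i _ _ => E.k_nonneg i
        obtain ⟨j, hj, rfl⟩ := Finset.mem_image.1 hi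
        simpa using hf j hj

/-- The top term of a linear combination with small coefficients dominates. -/
theorem le_abs_value {B : ℕ} {c : ℕ+ →₀ ℤ} (hB : ∀ j, |c j| ≤ B) {m : ℕ+} (hm : c m ≠ 0)
    (htop : ∀ j, m < j → c j = 0) :
    E.k (m : ℕ) - B * ∑ i ∈ Finset.range m, E.k (i : ℤ) ≤ |E.value c| := by
  have hc : c = Finsupp.single m (c m) + c.erase m := (Finsupp.single_add_erase m c).symm
  have h1 : |E.value (c.erase m)| ≤ B * ∑ i ∈ Finset.range m, E.k (i : ℤ) := by
    refine E.abs_value_le (fun j => ?_) fun j hj => ?_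
    · rcases eq_or_ne j m with rfl | h
      · simp
      · rw [Finsupp.erase_ne h]
        exact hB j
    · rw [Finsupp.support_erase, Finset.mem_erase, Finsupp.mem_support_iff] at hj
      exact lt_of_le_of_ne (not_lt.1 fun h => hj.2 (htop j h)) hj.1
  have h2 : E.value c = c m * E.k (m : ℕ) + E.value (c.erase m) := by
    conv_lhs => rw [hc]
    rw [map_add, E.value_single]
  have h3 : E.k (m : ℕ) ≤ |c m * E.k (m : ℕ)| := by
    rw [abs_mul, abs_of_nonneg (E.k_nonneg m)]
    exact le_mul_of_one_le_left (E.k_nonneg m) (Int.one_le_abs hm)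
  have h4 := abs_add_le (E.value c) (-E.value (c.erase m))
  rw [abs_neg, h2, add_neg_cancel_right] at h4
  rw [h2]
  linarith

theorem exists_top {c : ℕ+ →₀ ℤ} {i : ℕ+} (hi : c i ≠ 0) :
    ∃ m, i ≤ m ∧ c m ≠ 0 ∧ ∀ j, m < j → c j = 0 := by
  have hne : c.support.Nonempty := ⟨i, by simpa using hi⟩
  refine ⟨c.support.max' hne, Finset.le_max' _ _ (by simpa using hi), ?_, fun j hj => ?_⟩
  · simpa using c.support.max'_mem hne
  · by_contra h
    exact absurd (Finset.le_max' c.support j (by simpa using h)) (not_le.2 hj)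

/-- The top term outweighs the rest. The bound 3 allows for the difference between one sign vector
and a sum of two others, as needed for the return argument. -/
theorem eq_zero_of_value_eq_zero {c : ℕ+ →₀ ℤ} (hc : ∀ j, |c j| ≤ 3) (h : E.value c = 0) :
    c = 0 := by
  by_contra hne
  obtain ⟨i, hi⟩ := Finsupp.ne_iff.1 hne
  obtain ⟨m, -, hm, htop⟩ := exists_top hi
  have h1 := E.le_abs_value (B := 3) (by exact_mod_cast hc) hm htop
  have h2 := E.three_mul_sum_lt m m.pos
  rw [h, abs_zero] at h1
  push_cast at h1
  linarith

/-- With top index `m ≥ j`, the value is at least `k(m) - 2 ∑_{i<m} k(i) > ∑_{i<m} k(i) ≥ m - 1 ≥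
K`. The bound 2 covers differences of sign vectors. -/
theorem eq_zero_of_abs_value_le {c : ℕ+ →₀ ℤ} (hc : ∀ j, |c j| ≤ 2) {K : ℕ}
    (h : |E.value c| ≤ K) {j : ℕ+} (hj : K < j) : c j = 0 := by
  by_contra hne
  obtain ⟨m, hjm, hm, htop⟩ := exists_top hne
  have h1 := E.le_abs_value (B := 2) (by exact_mod_cast hc) hm htop
  have h2 := E.three_mul_sum_lt m m.pos
  have h3 := E.le_sum_k ((m : ℕ) - 1)
  rw [Nat.sub_add_cancel m.pos] at h3
  have h4 : (j : ℕ) ≤ m := hjm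
  push_cast at h1
  have h5 : (K : ℤ) ≤ ((m : ℕ) - 1 : ℕ) := by omega
  linarith

theorem value_injOn {c d : ℕ+ →₀ ℤ} (hc : IsSignVec c) (hd : IsSignVec d)
    (h : E.value c = E.value d) : c = d := by
  refine sub_eq_zero.1 (E.eq_zero_of_value_eq_zero (fun j => ?_) (by rw [map_sub, h, sub_self]))
  have h1 := hc j
  have h2 := hd j
  rw [Finsupp.sub_apply]
  rw [abs_le] at *
  omega

/-- If `c` and `d` are the expansions of `u + t` and `t`, where all indices in the expansion of
`t` exceed `|u|`, then `c` extends `d` by an expansion of `u`. -/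
theorem exists_eq_add {c d : ℕ+ →₀ ℤ} (hc : IsSignVec c) (hd : IsSignVec d) {u : ℤ}
    (hu : ∀ j ∈ d.support, u.natAbs < j) (h : E.value c = u + E.value d) :
    ∃ f, IsSignVec f ∧ E.value f = u ∧ c = f + d ∧ ∀ j, f j = 0 ∨ d j = 0 := by
  have hval : E.value (c - d) = u := by rw [map_sub, h, add_sub_cancel_right]
  have h2 : ∀ j, |(c - d) j| ≤ 2 := fun j => by
    have h1 := hc j
    have h2 := hd j
    rw [Finsupp.sub_apply]
    rw [abs_le] at *
    omega
  have hzero : ∀ j, (c - d) j = 0 ∨ d j = 0 := fun j => by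
    by_cases hj : d j = 0
    · exact Or.inr hj
    · exact Or.inl (E.eq_zero_of_abs_value_le h2 (K := u.natAbs) (by rw [hval]; simp)
        (hu j (by simpa using hj)))
  refine ⟨c - d, fun j => ?_, hval, by simp, hzero⟩
  rcases hzero j with h0 | h0
  · simp [h0]
  · simpa [h0] using hc j

theorem ell_eq {n l : ℕ+} (h : n ∈ E.D l) : E.ell n = l := by
  by_contra hne
  exact Set.disjoint_left.1 (E.D_disjoint _ _ hne) (E.D_cover n).choose_spec h

/-- Every vector is the length vector of an expansion with arbitrarily large indices. -/
theorem exists_lengthOf_eq (w : NVec) (K : ℕ) :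
    ∃ c, IsSignVec c ∧ E.lengthOf c = w ∧ ∀ j ∈ c.support, K < (j : ℕ) := by
  have add : ∀ v w : NVec,
      (∀ K : ℕ, ∃ c, IsSignVec c ∧ E.lengthOf c = v ∧ ∀ j ∈ c.support, K < (j : ℕ)) →
      (∀ K : ℕ, ∃ c, IsSignVec c ∧ E.lengthOf c = w ∧ ∀ j ∈ c.support, K < (j : ℕ)) →
      ∀ K : ℕ, ∃ c, IsSignVec c ∧ E.lengthOf c = v + w ∧ ∀ j ∈ c.support, K < (j : ℕ) := by
    intro v w hv hw K
    obtain ⟨c, hc, rfl, hcK⟩ := hv K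
    -- Starting beyond the support of `c` makes the two expansions disjoint, so that their length
    -- vectors add.
    obtain ⟨d, hd, rfl, hdK⟩ := hw (K + c.support.sup fun j : ℕ+ => (j : ℕ))
    have hdisj : ∀ j, c j = 0 ∨ d j = 0 := fun j => by
      by_contra! hj
      have h1 := hdK j (by simpa using hj.2)
      have h2 := Finset.le_sup (f := fun j : ℕ+ => (j : ℕ)) (Finsupp.mem_support_iff.2 hj.1)
      omega
    refine ⟨c + d, hc.add hd hdisj, E.lengthOf_add hdisj, fun j hj => ?_⟩
    rcases Finset.mem_union.1 (Finsupp.support_add hj) with h | h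
    · exact hcK j h
    · have := hdK j h
      omega
  have zero : ∀ K : ℕ, ∃ c, IsSignVec c ∧ E.lengthOf c = 0 ∧ ∀ j ∈ c.support, K < (j : ℕ) :=
    fun K => ⟨0, IsSignVec.zero, E.lengthOf_zero, by simp⟩
  induction w using Finsupp.induction_linear generalizing K with
  | zero => exact zero K
  | add v w hv hw => exact add v w hv hw K
  | single l n =>
    induction n generalizing K with
    | zero => simpa using zero K
    | succ n ih =>
      rw [Finsupp.single_add]
      refine add _ _ ih (fun K => ?_) K
      obtain ⟨j, hj, hjK⟩ := (E.D_infinite l).exists_gt K.succPNat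
      refine ⟨Finsupp.single j 1, fun i => ?_, ?_, fun i hi => ?_⟩
      · rw [Finsupp.single_apply]
        split_ifs <;> simp
      · rw [E.lengthOf_single, E.ell_eq hj]
        simp [unitVec]
      · rw [Finset.mem_singleton.1 (Finsupp.support_single_subset hi)]
        have : K + 1 < (j : ℕ) := hjK
        omega

/-! ### Lists of signed indices versus sign vectors -/

theorem lengthVec_cons (j : ℤ) (js : List ℤ) :
    E.lengthVec (j :: js) = unitVec (E.ell j.natAbs.toPNat') + E.lengthVec js := by
  simp [lengthVec]

theorem exists_signVec_of_list (js : List ℤ) (h0 : ∀ j ∈ js, j ≠ 0)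
    (hp : js.Pairwise fun i j => |j| < |i|) :
    ∃ c, IsSignVec c ∧ E.value c = (js.map E.k).sum ∧ E.lengthOf c = E.lengthVec js ∧
      ∀ i ∈ c.support, ∃ j ∈ js, (i : ℕ) = j.natAbs := by
  induction js with
  | nil => exact ⟨0, IsSignVec.zero, by simp, by simp [lengthVec, lengthOf_zero], by simp⟩
  | cons j js ih =>
    rw [List.pairwise_cons] at hp
    obtain ⟨c, hc, hv, hl, hs⟩ := ih (fun i hi => h0 i (List.mem_cons_of_mem _ hi)) hp.2
    have hj : j ≠ 0 := h0 j List.mem_cons_self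
    set i := j.natAbs.toPNat' with hi
    have hij : (i : ℕ) = j.natAbs := by
      rw [hi, Nat.toPNat'_coe, if_pos (Int.natAbs_pos.2 hj)]
    have hdisj : ∀ l, (Finsupp.single i j.sign) l = 0 ∨ c l = 0 := fun l => by
      by_contra! h
      have h1 : l = i := by
        by_contra hne
        exact h.1 (Finsupp.single_eq_of_ne hne)
      obtain ⟨j', hj', h2⟩ := hs l (by simpa using h.2)
      have := hp.1 j' hj'
      rw [h1, hij] at h2
      rw [Int.abs_eq_natAbs, Int.abs_eq_natAbs] at this
      omega
    refine ⟨Finsupp.single i j.sign + c, IsSignVec.add (fun l => ?_) hc hdisj, ?_, ?_, ?_⟩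
    · rw [Finsupp.single_apply]
      split_ifs
      · rw [Int.abs_eq_natAbs, Int.natAbs_sign_of_ne_zero hj]
        simp
      · simp
    · rw [map_add, hv, E.value_single, List.map_cons, List.sum_cons, hij]
      congr 1
      rcases lt_or_gt_of_ne hj with h | h
      · rw [Int.sign_eq_neg_one_of_neg h, Int.ofNat_natAbs_of_nonpos h.le, E.k_odd]
        ring
      · rw [Int.sign_eq_one_of_pos h, Int.natAbs_of_nonneg h.le, one_mul]
    · rw [E.lengthOf_add hdisj, hl, E.lengthVec_cons, E.lengthOf_single,
        Int.natAbs_sign_of_ne_zero hj, one_smul]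
    · intro l hl
      rcases Finset.mem_union.1 (Finsupp.support_add hl) with h | h
      · rw [Finset.mem_singleton.1 (Finsupp.support_single_subset h)]
        exact ⟨j, List.mem_cons_self, hij⟩
      · obtain ⟨j', hj', h2⟩ := hs l h
        exact ⟨j', List.mem_cons_of_mem _ hj', h2⟩

theorem exists_list_of_signVec (c : ℕ+ →₀ ℤ) (hc : IsSignVec c) :
    ∃ js : List ℤ, E.IsExpansion js (E.value c) ∧ E.lengthVec js = E.lengthOf c ∧
      ∀ j ∈ js, ∃ i ∈ c.support, (i : ℕ) = j.natAbs := by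
  -- Peeling off the largest index matches the order of decreasing absolute values in the list.
  induction c using Finsupp.induction_on_max with
  | zero => exact ⟨[], ⟨by simp, by simp, by simp⟩, by simp [lengthVec, lengthOf_zero], by simp⟩
  | single_add m a f hf ha ih =>
    have hfm : f m = 0 := by
      by_contra h
      exact lt_irrefl _ (hf m (by simpa using h))
    have hdisj : ∀ l, (Finsupp.single m a) l = 0 ∨ f l = 0 := fun l => by
      rcases eq_or_ne l m with rfl | h
      · exact Or.inr hfm
      · exact Or.inl (Finsupp.single_eq_of_ne h)
    have ha1 : |a| = 1 := by
      have h1 := hc m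
      rw [Finsupp.add_apply, hfm, Finsupp.single_eq_same, add_zero] at h1
      exact le_antisymm h1 (Int.one_le_abs ha)
    have ha2 : a.natAbs = 1 := by
      rw [Int.abs_eq_natAbs] at ha1
      exact_mod_cast ha1
    obtain ⟨js, ⟨h0, hp, hv⟩, hl, hs⟩ := ih fun l => by
      rcases hdisj l with h | h
      · simpa [h] using hc l
      · simp [h]
    have habs : (a * (m : ℕ)).natAbs = m := by
      rw [Int.natAbs_mul, Int.natAbs_natCast]
      rw [ha2, one_mul]
    refine ⟨(a * (m : ℕ)) :: js, ⟨fun j hj => ?_, ?_, ?_⟩, ?_, fun j hj => ?_⟩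
    · rcases List.mem_cons.1 hj with rfl | hj
      · exact mul_ne_zero ha (by exact_mod_cast m.ne_zero)
      · exact h0 j hj
    · refine List.pairwise_cons.2 ⟨fun j hj => ?_, hp⟩
      obtain ⟨i, hi, hij⟩ := hs j hj
      have h1 : (i : ℕ) < m := hf i hi
      rw [Int.abs_eq_natAbs, Int.abs_eq_natAbs, habs]
      omega
    · rw [map_add, hv, E.value_single, List.map_cons, List.sum_cons]
      congr 1
      rcases (abs_eq (by norm_num)).1 ha1 with rfl | rfl
      · simp
      · rw [neg_one_mul, neg_one_mul, E.k_odd]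
    · rw [E.lengthVec_cons, hl, E.lengthOf_add hdisj, E.lengthOf_single, habs, PNat.coe_toPNat']
      rw [ha2, one_smul]
    · rcases List.mem_cons.1 hj with rfl | hj
      · refine ⟨m, ?_, habs.symm⟩
        rw [Finsupp.mem_support_iff, Finsupp.add_apply, hfm, Finsupp.single_eq_same, add_zero]
        exact ha
      · obtain ⟨i, hi, hij⟩ := hs j hj
        refine ⟨i, ?_, hij⟩
        rw [Finsupp.mem_support_iff, Finsupp.add_apply]
        rcases hdisj i with h | h
        · simpa [h] using hi
        · simp [h] at hi

/-! ### Membership in `A[M]` and in its translates -/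

theorem mem_timeSet {M : NLabel} {t : ℤ} :
    t ∈ E.timeSet M ↔ ∃ c, IsSignVec c ∧ E.value c = t ∧ E.lengthOf c ∈ M.carrier := by
  constructor
  · rintro ⟨js, ⟨h0, hp, rfl⟩, hM⟩
    obtain ⟨c, hc, hv, hl, -⟩ := E.exists_signVec_of_list js h0 hp
    exact ⟨c, hc, hv, hl ▸ hM⟩
  · rintro ⟨c, hc, rfl, hM⟩
    obtain ⟨js, hjs, hl, -⟩ := E.exists_list_of_signVec c hc
    exact ⟨js, hjs, hl ▸ hM⟩

theorem value_mem_timeSet {M : NLabel} {c : ℕ+ →₀ ℤ} (hc : IsSignVec c) :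
    E.value c ∈ E.timeSet M ↔ E.lengthOf c ∈ M.carrier := by
  rw [E.mem_timeSet]
  constructor
  · rintro ⟨d, hd, h, hM⟩
    rwa [← E.value_injOn hd hc h]
  · exact fun h => ⟨c, hc, rfl, h⟩

/-- An expansion of `u` uses only indices at most `|u|`, so it is disjoint from `d`; by uniqueness,
any expansion of the sum splits off `d`, and length vectors add. -/
theorem add_value_mem_timeSet {M : NLabel} {d : ℕ+ →₀ ℤ} (hd : IsSignVec d) {u : ℤ}
    (hu : ∀ j ∈ d.support, u.natAbs < j) :
    u + E.value d ∈ E.timeSet M ↔ u ∈ E.timeSet (M.sub (E.lengthOf d)) := by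
  rw [E.mem_timeSet, E.mem_timeSet]
  constructor
  · rintro ⟨c, hc, h, hM⟩
    obtain ⟨f, hf, hfu, rfl, hdisj⟩ := E.exists_eq_add hc hd hu h
    exact ⟨f, hf, hfu, by rwa [E.lengthOf_add hdisj] at hM⟩
  · rintro ⟨f, hf, rfl, hM⟩
    have hdisj : ∀ j, f j = 0 ∨ d j = 0 := fun j => by
      by_cases hj : d j = 0
      · exact Or.inr hj
      · refine Or.inl (E.eq_zero_of_abs_value_le (K := (E.value f).natAbs) (fun j => ?_)
          (by simp) (hu j (by simpa using hj)))
        exact (hf j).trans (by norm_num)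
    refine ⟨f + d, hf.add hd hdisj, map_add _ _ _, ?_⟩
    rw [E.lengthOf_add hdisj]
    exact hM

end ExpansionSystem
end

noncomputable section

/-! ### Convergence of labels -/

theorem boxSet_finite (N : ℕ) : (boxSet N).Finite := by
  refine (Set.finite_Iic
    (Finsupp.indicator (Finset.Icc 1 N.succPNat) fun _ _ => N : NVec)).subset ?_
  rintro m ⟨-, h1, h2⟩ l
  by_cases hl : l ∈ Finset.Icc 1 N.succPNat
  · rw [Finsupp.indicator_of_mem hl]
    exact h1 l
  · have : m l = 0 := by
      by_contra h
      refine hl (Finset.mem_Icc.2 ⟨one_le, ?_⟩)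
      have := h2 l (by simpa using h)
      exact (show (l : ℕ) ≤ N + 1 by omega)
    rw [this]
    exact Nat.zero_le _

namespace NLabel

/-- Each box is finite, so convergence in the ultrametric follows from convergence of each single
membership. -/
theorem tendsto_of_eventually {ι : Type*} {f : ι → NLabel} {l : Filter ι} {N : NLabel}
    (h : ∀ w, ∀ᶠ i in l, (w ∈ (f i).carrier ↔ w ∈ N.carrier)) : Tendsto f l (𝓝 N) := by
  rw [Metric.tendsto_nhds]
  intro ε hε
  obtain ⟨n, hn⟩ := exists_pow_lt_of_lt_one hε (show (1 / 2 : ℝ) < 1 by norm_num)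
  have := (eventually_all_finite (boxSet_finite (n + 1))).2 fun w _ => h w
  filter_upwards [this] with i hi
  refine ((dist_lt_iff _ _ n).2 ?_).trans hn
  ext w
  exact ⟨fun hw => ⟨(hi w hw.2).1 hw.1, hw.2⟩, fun hw => ⟨(hi w hw.2).2 hw.1, hw.2⟩⟩

theorem eventually_mem_iff (N : NLabel) (w : NVec) :
    ∀ᶠ N' in 𝓝 N, (w ∈ N'.carrier ↔ w ∈ N.carrier) := by
  obtain ⟨n, hn⟩ := exists_mem_boxSet w
  filter_upwards [Metric.ball_mem_nhds N (show (0 : ℝ) < (1 / 2) ^ n by positivity)] with N' hN'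
  have := congrArg (w ∈ ·) ((dist_lt_iff _ _ n).1 hN')
  simpa [boxSet_mono (Nat.le_succ n) hn] using this

/-- The limit of the labels `M - r_i` along an ultrafilter. -/
def subLimit (M : NLabel) {ι : Type*} (F : Ultrafilter ι) (r : ι → NVec) : NLabel where
  carrier := {w | ∀ᶠ i in F, w + r i ∈ M.carrier}
  hereditary := fun h hm => Eventually.mono hm fun _ => M.hereditary (by gcongr)

/-- An ultrafilter decides every membership, so the limit always exists. -/
theorem tendsto_subLimit (M : NLabel) {ι : Type*} (F : Ultrafilter ι) (r : ι → NVec) :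
    Tendsto (fun i => M.sub (r i)) F (𝓝 (M.subLimit F r)) := by
  refine tendsto_of_eventually fun w => ?_
  by_cases h : w ∈ (M.subLimit F r).carrier
  · exact Eventually.mono h fun i hi => ⟨fun _ => h, fun _ => hi⟩
  · exact (Ultrafilter.eventually_not.2 h).mono fun i hi => ⟨fun h' => absurd h' hi, fun h' =>
      absurd h' h⟩

theorem subLimit_mem_Theta (M : NLabel) {ι : Type*} (F : Ultrafilter ι) (r : ι → NVec) :
    M.subLimit F r ∈ M.Theta :=
  mem_closure_of_tendsto (M.tendsto_subLimit F r) (Eventually.of_forall fun i => ⟨r i, rfl⟩)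

theorem subLimit_subset (M : NLabel) {ι : Type*} (F : Ultrafilter ι) (r : ι → NVec) :
    (M.subLimit F r).carrier ⊆ M.carrier := fun _ hw =>
  let ⟨_, hi⟩ := Eventually.exists hw
  M.hereditary le_self_add hi

theorem IsFiniteType.mono {M N : NLabel} (hM : M.IsFiniteType) (h : N.carrier ⊆ M.carrier) :
    N.IsFiniteType := fun ⟨f, hf, hN⟩ => hM ⟨f, hf, fun n => h (hN n)⟩

theorem IsFiniteType.exists_maximal {M : NLabel} (hM : M.IsFiniteType)
    (hne : M.carrier.Nonempty) : ∃ w ∈ M.carrier, ∀ r, w + r ∈ M.carrier → r = 0 := by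
  by_contra! h
  choose! g hg hg0 using h
  obtain ⟨w, hw⟩ := hne
  -- Without a maximal vector, repeatedly adding a nonzero `g v` produces a forbidden strictly
  -- increasing sequence.
  let f : ℕ → M.carrier := fun n => Nat.rec ⟨w, hw⟩ (fun _ v => ⟨v + g v, hg v v.2⟩) n
  refine hM ⟨fun n => (f n).1, strictMono_nat_of_lt_succ fun n => ?_, fun n => ?_⟩
  · change (f n).1 < (f n).1 + g (f n).1
    exact lt_add_of_pos_right _ (pos_iff_ne_zero.2 (hg0 _ (f n).2))
  · exact (f n).2

theorem IsFiniteType.exists_notMem {M : NLabel} (hM : M.IsFiniteType) :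
    ∃ w, w ∉ M.carrier := by
  by_contra! h
  refine hM ⟨fun n => Finsupp.single 1 n, strictMono_nat_of_lt_succ fun n => ?_, fun n => h _⟩
  rw [Finsupp.single_add]
  exact lt_add_of_pos_right _ (pos_iff_ne_zero.2 (by simp))

/-- Infinitely many nonzero terms would have strictly increasing partial sums in `M`. -/
theorem IsFiniteType.finite_of_sum_mem {M : NLabel} (hM : M.IsFiniteType) {ι : Type*}
    {v : ι → NVec} (h : ∀ s : Finset ι, ∑ j ∈ s, v j ∈ M.carrier) : {j | v j ≠ 0}.Finite := by
  by_contra hinf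
  set e := Set.Infinite.natEmbedding _ hinf
  refine hM ⟨fun n => ∑ i ∈ Finset.range n, v (e i), strictMono_nat_of_lt_succ fun n => ?_,
    fun n => ?_⟩
  · rw [Finset.sum_range_succ]
    exact lt_add_of_pos_right _ (pos_iff_ne_zero.2 (e n).2)
  · have := h ((Finset.range n).map (e.trans (Function.Embedding.subtype _)))
    rwa [Finset.sum_map] at this

end NLabel

/-! ### The labeled subshifts -/

theorem binaryShift_zpow_apply (n : ℤ) (x : ℤ → Bool) (t : ℤ) :
    (binaryShift ^ n) x t = x (t + n) := by
  induction n using Int.induction_on generalizing x t with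
  | zero => simp
  | succ n ih =>
    rw [zpow_add_one, Homeomorph.mul_apply, ih]
    change x (t + n + 1) = _
    rw [add_assoc]
  | pred n ih =>
    rw [zpow_sub_one, Homeomorph.mul_apply, ih]
    change x (t + -n - 1) = _
    congr 1
    ring

theorem exists_ultrafilter_of_mem_closure_range {ι X : Type*} [TopologicalSpace X] {f : ι → X}
    {x : X} (h : x ∈ closure (Set.range f)) :
    ∃ F : Ultrafilter ι, Tendsto f F (𝓝 x) := by
  obtain ⟨u, hu, hux⟩ := mem_closure_iff_ultrafilter.1 h
  rw [← Set.image_univ] at hu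
  refine ⟨Ultrafilter.ofComapInfPrincipal hu, ?_⟩
  rw [Tendsto, ← Ultrafilter.coe_map, Ultrafilter.ofComapInfPrincipal_eq_of_map]
  exact hux

namespace ExpansionSystem

variable (E : ExpansionSystem)

theorem point_eq_true {M : NLabel} {t : ℤ} : E.point M t = true ↔ t ∈ E.timeSet M := by
  simp [point]

theorem zero_mem_timeSet {M : NLabel} (h : 0 ∈ M.carrier) : 0 ∈ E.timeSet M :=
  E.mem_timeSet.2 ⟨0, IsSignVec.zero, map_zero _, by rwa [E.lengthOf_zero]⟩

theorem eventually_mem_timeSet_iff (N : NLabel) (t : ℤ) :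
    ∀ᶠ N' in 𝓝 N, (t ∈ E.timeSet N' ↔ t ∈ E.timeSet N) := by
  by_cases h : ∃ c, IsSignVec c ∧ E.value c = t
  · obtain ⟨c, hc, rfl⟩ := h
    filter_upwards [N.eventually_mem_iff (E.lengthOf c)] with N' hN'
    rw [E.value_mem_timeSet hc, E.value_mem_timeSet hc, hN']
  · refine Eventually.of_forall fun N' => ?_
    rw [E.mem_timeSet, E.mem_timeSet]
    exact ⟨fun ⟨c, hc, ht, _⟩ => absurd ⟨c, hc, ht⟩ h, fun ⟨c, hc, ht, _⟩ => absurd ⟨c, hc, ht⟩ h⟩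

theorem tendsto_boolSeq {ι : Type*} {l : Filter ι} {f : ι → ℤ → Bool} {x : ℤ → Bool}
    (h : ∀ t, ∀ᶠ i in l, (f i t = true ↔ x t = true)) : Tendsto f l (𝓝 x) :=
  tendsto_pi_nhds.2 fun t => tendsto_const_nhds.congr' ((h t).mono fun _ hi =>
    (Bool.eq_iff_iff.2 hi).symm)

theorem continuous_point : Continuous E.point :=
  continuous_iff_continuousAt.2 fun N => tendsto_boolSeq fun t => by
    simpa only [point_eq_true] using E.eventually_mem_timeSet_iff N t

/-- Every vector is the length vector of some expansion, and by uniqueness the symbol at its value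
tests membership of that vector. -/
theorem point_injective : Function.Injective E.point := fun M N h => by
  ext w
  obtain ⟨c, hc, rfl, -⟩ := E.exists_lengthOf_eq w 0
  rw [← E.value_mem_timeSet hc, ← E.value_mem_timeSet hc, ← point_eq_true, h, point_eq_true]

theorem point_sub_mem_subshift (M : NLabel) (r : NVec) : E.point (M.sub r) ∈ E.subshift M := by
  choose c hc hr hK using E.exists_lengthOf_eq r
  refine mem_closure_of_tendsto (b := atTop)
    (f := fun K => (binaryShift ^ (E.value (c K))) (E.point M)) (tendsto_boolSeq fun t => ?_)
    (Eventually.of_forall fun K => ⟨_, rfl⟩)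
  filter_upwards [eventually_ge_atTop t.natAbs] with K hKt
  rw [binaryShift_zpow_apply, point_eq_true, point_eq_true,
    E.add_value_mem_timeSet (hc K) fun j hj => hKt.trans_lt (hK K j hj), hr]

theorem point_mem_subshift_of_mem_Theta {M N : NLabel} (h : N ∈ M.Theta) :
    E.point N ∈ E.subshift M := by
  refine closure_minimal ?_ (isClosed_closure.preimage E.continuous_point) h
  rintro _ ⟨r, rfl⟩
  exact E.point_sub_mem_subshift M r

theorem not_countable_subshift {M : NLabel} (h : ¬ M.Theta.Countable) :
    ¬ (E.subshift M).Countable := fun hc =>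
  h (Set.MapsTo.countable_of_injOn (fun _ hN => E.point_mem_subshift_of_mem_Theta hN)
    E.point_injective.injOn hc)

/-- For `r ∉ M` the label `M - r` is empty, and its point is the zero sequence. -/
theorem zero_mem_subshift {M : NLabel} (hM : M.IsFiniteType) :
    (fun _ => false) ∈ E.subshift M := by
  obtain ⟨r, hr⟩ := hM.exists_notMem
  convert E.point_sub_mem_subshift M r using 1
  funext t
  symm
  rw [Bool.eq_false_iff, ne_eq, point_eq_true, mem_timeSet]
  rintro ⟨c, -, -, hc⟩
  exact hr (M.hereditary le_add_self hc)

/-- Limits of translates of `A[M]` by times in `A[M]`. -/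
theorem exists_limit {M : NLabel} (hM : M.IsFiniteType) (F : Ultrafilter ℤ)
    (hF : E.timeSet M ∈ F) :
    ∃ N : NLabel, N.carrier ⊆ M.carrier ∧ 0 ∈ N.carrier ∧
      ∃ s : ℤ, ∀ u, ∀ᶠ n in F, (u + n ∈ E.timeSet M ↔ u + s ∈ E.timeSet N) := by
  have hex : ∀ n ∈ E.timeSet M, ∃ c, IsSignVec c ∧ E.value c = n ∧ E.lengthOf c ∈ M.carrier :=
    fun n hn => E.mem_timeSet.1 hn
  choose! c hc hv hl using hex
  -- Each coefficient takes only the values -1, 0, 1, so it is constant along the ultrafilter.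
  have hlim : ∀ j, ∃ a : ℤ, ∀ᶠ n in F, c n j = a := fun j => by
    obtain ⟨a, -, ha⟩ := (Ultrafilter.eventually_exists_mem_iff (f := F)
      (Set.finite_Icc (-1 : ℤ) 1) (P := fun a n => c n j = a)).1
        (Eventually.mono hF fun n hn => ⟨c n j, abs_le.1 (hc n hn j), rfl⟩)
    exact ⟨a, ha⟩
  choose a ha using hlim
  have haF : ∀ s : Set ℕ+, s.Finite → ∀ᶠ n in F, ∀ j ∈ s, c n j = a j := fun s hs =>
    (eventually_all_finite hs).2 fun j _ => ha j
  -- Any finite part of `a` agrees with part of some actual `c n`, so its length vector lies in `M`;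
  -- finite type then bounds the support.
  have hfin : (Function.support a).Finite := by
    refine (hM.finite_of_sum_mem (v := fun j => (a j).natAbs • unitVec (E.ell j))
      fun s => ?_).subset fun j hj => ?_
    · obtain ⟨n, hn, hs⟩ := (Eventually.and hF (haF s s.finite_toSet)).exists
      refine M.hereditary ?_ (hl n hn)
      rw [Finset.sum_congr rfl fun j hj => by rw [← hs j hj], lengthOf,
        Finsupp.sum_of_support_subset _ (Finset.subset_union_left (s₂ := s)) _ (by simp)]
      exact Finset.sum_le_sum_of_subset Finset.subset_union_right
    · change _ • Finsupp.single _ 1 ≠ (0 : NVec)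
      simpa using hj
  set b : ℕ+ →₀ ℤ := Finsupp.ofSupportFinite a hfin with hb
  have hba : ∀ j, b j = a j := fun j => rfl
  set d : ℤ → ℕ+ →₀ ℤ := fun n => c n - b with hd
  have hdb : ∀ᶠ n in F, ∀ j, d n j = 0 ∨ b j = 0 := by
    filter_upwards [haF _ hfin] with n hn j
    by_cases hj : a j = 0
    · exact Or.inr hj
    · exact Or.inl (by rw [hd, Finsupp.sub_apply, hba, hn j hj, sub_self])
  have hdsign : ∀ᶠ n in F, IsSignVec (d n) := by
    filter_upwards [hdb, hF] with n hn hnM j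
    rcases hn j with h | h
    · simp [h]
    · rw [hd, Finsupp.sub_apply, h, sub_zero]
      exact hc n hnM j
  have hdK : ∀ K : ℕ, ∀ᶠ n in F, ∀ j ∈ (d n).support, K < (j : ℕ) := fun K => by
    filter_upwards [haF (Set.Iic K.succPNat) (Set.finite_Iic _)] with n hn j hj
    by_contra! hle
    rw [Finsupp.mem_support_iff] at hj
    refine hj ?_
    rw [hd, Finsupp.sub_apply, hba, hn j (show (j : ℕ) ≤ K + 1 by omega), sub_self]
  -- The remainders `d n` have indices tending to infinity, so only their length vectors survive in
  -- the limit, through the labels `M - r n`.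
  set r : ℤ → NVec := fun n => E.lengthOf (d n) with hr
  refine ⟨M.subLimit F r, M.subLimit_subset F r, ?_, E.value b, fun u => ?_⟩
  · change ∀ᶠ n in F, 0 + r n ∈ M.carrier
    filter_upwards [hdb, hF] with n hn hnM
    have h := hl n hnM
    rw [show c n = d n + b by simp [hd], E.lengthOf_add hn] at h
    rw [zero_add]
    exact M.hereditary le_self_add h
  · filter_upwards [hdsign, hdK (u + E.value b).natAbs, hF,
      (M.tendsto_subLimit F r).eventually (E.eventually_mem_timeSet_iff _ (u + E.value b))]
      with n h1 h2 h3 h4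
    rw [← h4, ← E.add_value_mem_timeSet h1 h2, hd, map_sub, hv n h3]
    congr! 1
    ring

theorem exists_eq_zpow_point {M : NLabel} (hM : M.IsFiniteType) {x : ℤ → Bool}
    (hx : x ∈ E.subshift M) (hx0 : x ≠ fun _ => false) :
    ∃ N : NLabel, N.IsFiniteType ∧ 0 ∈ N.carrier ∧ ∃ a : ℤ, x = (binaryShift ^ a) (E.point N) := by
  obtain ⟨F, hF⟩ := exists_ultrafilter_of_mem_closure_range hx
  have hFu : ∀ u, ∀ᶠ n in F, (u + n ∈ E.timeSet M ↔ x u = true) := fun u => by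
    have h := tendsto_pi_nhds.1 hF u
    rw [nhds_discrete, tendsto_pure] at h
    filter_upwards [h] with n hn
    rw [← hn, binaryShift_zpow_apply, point_eq_true]
  obtain ⟨u, hu⟩ := Function.ne_iff.1 hx0
  rw [Bool.ne_false_iff] at hu
  -- A coordinate `u` with `x u = true` makes the times `u + n` eventually lie in `A[M]`, as
  -- `exists_limit` requires.
  obtain ⟨N, hNM, hN0, s, hs⟩ := E.exists_limit hM (F.map fun n => u + n)
    ((hFu u).mono fun n hn => hn.2 hu)
  refine ⟨N, hM.mono hNM, hN0, s - u, funext fun t => ?_⟩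
  obtain ⟨n, h1, h2⟩ := (Eventually.and (hFu t) (hs (t - u))).exists
  have h2 : t - u + (u + n) ∈ E.timeSet M ↔ t - u + s ∈ E.timeSet N := h2
  rw [binaryShift_zpow_apply, Bool.eq_iff_iff, point_eq_true, ← h1,
    show t + (s - u) = t - u + s by ring, ← h2]
  congr! 1
  ring

end ExpansionSystem
end

noncomputable section

/-! ### Isolated points, recurrence and almost equicontinuity -/

theorem zpow_mem_orbitClosure {X : Type*} [TopologicalSpace X] (T : X ≃ₜ X) (x : X) (n : ℤ) :
    (T ^ n) x ∈ orbitClosure T x :=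
  subset_closure ⟨n, rfl⟩

theorem self_mem_orbitClosure {X : Type*} [TopologicalSpace X] (T : X ≃ₜ X) (x : X) :
    x ∈ orbitClosure T x := by
  simpa using zpow_mem_orbitClosure T x 0

theorem zpow_apply_zpow {X : Type*} [TopologicalSpace X] (T : X ≃ₜ X) (m n : ℤ) (x : X) :
    (T ^ m) ((T ^ n) x) = (T ^ (m + n)) x := by
  rw [zpow_add, Homeomorph.mul_apply]

theorem image_iUnion_int_eq {X : Type*} [TopologicalSpace X] (T : X ≃ₜ X) (f : ℤ → Set X)
    (hf : ∀ n, T '' f n = f (n + 1)) : T '' (⋃ n, f n) = ⋃ n, f n := by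
  rw [Set.image_iUnion]
  simp_rw [hf]
  exact (Equiv.addRight (1 : ℤ)).surjective.iUnion_comp f

theorem isSubsystem_orbitClosure {X : Type*} [TopologicalSpace X] (T : X ≃ₜ X) (x : X) :
    IsSubsystem T (orbitClosure T x) := by
  refine ⟨⟨x, self_mem_orbitClosure T x⟩, isClosed_closure, ?_⟩
  rw [orbitClosure, T.image_closure, ← Set.iUnion_singleton_eq_range,
    image_iUnion_int_eq T _ fun n => ?_]
  rw [Set.image_singleton, add_comm, zpow_one_add, Homeomorph.mul_apply]

theorem isTopTransitive_orbitClosure {X : Type*} [TopologicalSpace X] (T : X ≃ₜ X) (x : X) :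
    IsTopTransitive T (orbitClosure T x) := by
  rintro U V hU hV ⟨y, hyU, hy⟩ ⟨z, hzV, hz⟩
  obtain ⟨_, hm, m, rfl⟩ := mem_closure_iff.1 hy U hU hyU
  obtain ⟨_, hn, n, rfl⟩ := mem_closure_iff.1 hz V hV hzV
  refine ⟨m - n, (T ^ n) x, ?_, hn, zpow_mem_orbitClosure T x n⟩
  change (T ^ (m - n)) ((T ^ n) x) ∈ U ∩ _
  rw [zpow_apply_zpow, sub_add_cancel]
  exact ⟨hm, zpow_mem_orbitClosure T x m⟩

theorem IsIsolatedIn.isEquicontinuityPt {X : Type*} [UniformSpace X] {T : X ≃ₜ X} {Y : Set X}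
    {x : X} (h : IsIsolatedIn Y x) : IsEquicontinuityPt T Y x := by
  obtain ⟨U, hU, hUY⟩ := h
  have hx : x ∈ U ∩ Y := hUY ▸ rfl
  refine ⟨hx.2, fun V hV => ?_⟩
  filter_upwards [mem_nhdsWithin_of_mem_nhds (hU.mem_nhds hx.1), self_mem_nhdsWithin] with y h1 h2 n
  have : y ∈ ({x} : Set X) := hUY ▸ ⟨h1, h2⟩
  rw [Set.mem_singleton_iff.1 this]
  exact refl_mem_uniformity hV

/-- If no nontrivial iterate of `x` returns to the neighbourhood `U`, then `x` is isolated in its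
orbit closure. -/
theorem isIsolatedIn_of_return {X : Type*} [TopologicalSpace X] [T1Space X] {T : X ≃ₜ X} {x : X}
    {U : Set X} (hU : IsOpen U) (hx : x ∈ U) (h : ∀ n : ℤ, (T ^ n) x ∈ U → n = 0) :
    IsIsolatedIn (orbitClosure T x) x := by
  refine ⟨U, hU, Set.Subset.antisymm ?_ (by simpa using ⟨hx, self_mem_orbitClosure T x⟩)⟩
  rintro y ⟨hyU, hy⟩
  have : y ∈ closure (U ∩ Set.range fun n : ℤ => (T ^ n) x) :=
    hU.inter_closure ⟨hyU, hy⟩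
  have hsub : U ∩ (Set.range fun n : ℤ => (T ^ n) x) ⊆ {x} := by
    rintro _ ⟨hn, n, rfl⟩
    simp [h n hn]
  simpa using closure_mono hsub this

theorem not_isRecurrentPt_of_return {X : Type*} [TopologicalSpace X] {T : X ≃ₜ X} {x : X}
    {U : Set X} (hU : IsOpen U) (hx : x ∈ U) (h : ∀ n : ℤ, (T ^ n) x ∈ U → n = 0) :
    ¬ IsRecurrentPt T x := by
  rintro (⟨n, hn, ht⟩ | ⟨n, hn, ht⟩)
  all_goals
    obtain ⟨i, hi, h0⟩ := ((ht.eventually (hU.mem_nhds hx)).and (eventually_gt_atTop 0)).exists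
    have h1 := h _ hi
    have h2 := hn h0
    omega

namespace ExpansionSystem

variable (E : ExpansionSystem)

theorem exists_isOpen_return {N : NLabel} (hN : N.IsFiniteType) (h0 : 0 ∈ N.carrier) :
    ∃ U : Set (ℤ → Bool), IsOpen U ∧ E.point N ∈ U ∧
      ∀ n : ℤ, (binaryShift ^ n) (E.point N) ∈ U → n = 0 := by
  obtain ⟨w, hw, hmax⟩ := hN.exists_maximal ⟨0, h0⟩
  obtain ⟨c, hc, rfl, -⟩ := E.exists_lengthOf_eq w 0
  have hopen : ∀ t : ℤ, IsOpen {y : ℤ → Bool | y t = true} := fun t =>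
    by
    have h := (isOpen_discrete ({true} : Set Bool)).preimage (continuous_apply (A := fun _ : ℤ => Bool) t)
    exact h
  refine ⟨{y | y 0 = true} ∩ ({y | y (E.value c) = true} ∩ {y | y (E.value (-c)) = true}),
    (hopen _).inter ((hopen _).inter (hopen _)),
    ⟨E.point_eq_true.2 (E.zero_mem_timeSet h0), E.point_eq_true.2 ((E.value_mem_timeSet hc).2 hw),
      E.point_eq_true.2 ((E.value_mem_timeSet hc.neg).2 (by rwa [E.lengthOf_neg]))⟩, ?_⟩
  rintro n ⟨hn, hp, hm⟩
  rw [Set.mem_ofPred_eq, binaryShift_zpow_apply, point_eq_true] at hn hp hm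
  rw [zero_add] at hn
  obtain ⟨d, hd, rfl, -⟩ := E.mem_timeSet.1 hn
  rw [← map_add] at hp hm
  have key : ∀ e, IsSignVec e → E.value (e + d) ∈ E.timeSet N →
      IsSignVec (e + d) ∧ E.lengthOf (e + d) ∈ N.carrier := fun e he h => by
    obtain ⟨f, hf, hfe, hfN⟩ := E.mem_timeSet.1 h
    -- The difference of the two sides has coefficients at most 3, so uniqueness still applies
    -- although `e + d` is not yet known to be a sign vector.
    have : f = e + d := by
      refine sub_eq_zero.1 (E.eq_zero_of_value_eq_zero (fun j => ?_)
        (by rw [map_sub, hfe, sub_self]))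
      have h1 := abs_le.1 (hf j)
      have h2 := abs_le.1 (he j)
      have h3 := abs_le.1 (hd j)
      rw [Finsupp.sub_apply, Finsupp.add_apply, abs_le]
      omega
    exact this ▸ ⟨hf, hfN⟩
  obtain ⟨hsp, hNp⟩ := key c hc hp
  obtain ⟨hsm, -⟩ := key (-c) hc.neg hm
  -- At a common index, one of `c + d` and `-c + d` would have a coefficient `±2`. This is why both
  -- signs of `c` enter the neighbourhood.
  have hdisj : ∀ j, c j = 0 ∨ d j = 0 := fun j => by
    have h1 := abs_le.1 (hsp j)
    have h2 := abs_le.1 (hsm j)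
    have h3 := abs_le.1 (hc j)
    have h4 := abs_le.1 (hd j)
    rw [Finsupp.add_apply] at h1 h2
    rw [Finsupp.neg_apply] at h2
    omega
  rw [E.lengthOf_add hdisj] at hNp
  rw [E.eq_zero_of_lengthOf_eq_zero (hmax _ hNp), map_zero]

theorem exists_isOpen_return_of_mem_subshift {M : NLabel} (hM : M.IsFiniteType) {x : ℤ → Bool}
    (hx : x ∈ E.subshift M) (hx0 : x ≠ fun _ => false) :
    ∃ U : Set (ℤ → Bool), IsOpen U ∧ x ∈ U ∧ ∀ n : ℤ, (binaryShift ^ n) x ∈ U → n = 0 := by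
  obtain ⟨N, hN, h0, a, rfl⟩ := E.exists_eq_zpow_point hM hx hx0
  obtain ⟨U, hU, hmem, hret⟩ := E.exists_isOpen_return hN h0
  refine ⟨(binaryShift ^ (-a)) ⁻¹' U, hU.preimage (binaryShift ^ (-a)).continuous, ?_,
    fun n hn => hret n ?_⟩
  · rw [Set.mem_preimage, zpow_apply_zpow]
    simpa using hmem
  · rw [Set.mem_preimage, zpow_apply_zpow, zpow_apply_zpow] at hn
    convert hn using 3
    ring

end ExpansionSystem

theorem binaryShift_zpow_zero (n : ℤ) :
    (binaryShift ^ n) (fun _ => false) = fun _ => false :=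
  funext fun t => binaryShift_zpow_apply n _ t

namespace ExpansionSystem

variable (E : ExpansionSystem)

theorem mem_subshift_and_isRecurrentPt_iff {M : NLabel} (hM : M.IsFiniteType) (x : ℤ → Bool) :
    (x ∈ E.subshift M ∧ IsRecurrentPt binaryShift x) ↔ x = fun _ => false := by
  constructor
  · rintro ⟨hx, hr⟩
    by_contra hx0
    obtain ⟨U, hU, hmem, hret⟩ := E.exists_isOpen_return_of_mem_subshift hM hx hx0
    exact not_isRecurrentPt_of_return hU hmem hret hr
  · rintro rfl
    refine ⟨E.zero_mem_subshift hM, Or.inl ⟨id, strictMono_id, ?_⟩⟩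
    simp only [binaryShift_zpow_zero]
    exact tendsto_const_nhds

theorem isIsolatedIn_orbitClosure {M : NLabel} (hM : M.IsFiniteType) {x : ℤ → Bool}
    (hx : x ∈ E.subshift M) : IsIsolatedIn (orbitClosure binaryShift x) x := by
  by_cases hx0 : x = fun _ => false
  · subst hx0
    refine ⟨Set.univ, isOpen_univ, ?_⟩
    simp only [orbitClosure, binaryShift_zpow_zero, Set.range_const, closure_singleton,
      Set.univ_inter]
  · obtain ⟨U, hU, hmem, hret⟩ := E.exists_isOpen_return_of_mem_subshift hM hx hx0
    exact isIsolatedIn_of_return hU hmem hret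

end ExpansionSystem

/-- The shift is expansive: equicontinuity points are isolated. -/
theorem IsEquicontinuityPt.eventually_eq {Y : Set (ℤ → Bool)} {x : ℤ → Bool}
    (h : IsEquicontinuityPt binaryShift Y x) : ∀ᶠ y in 𝓝[Y] x, y = x := by
  -- Closeness for the entourage at coordinate 0 under all shifts means equality at every
  -- coordinate.
  have hV : {p : (ℤ → Bool) × (ℤ → Bool) | p.1 0 = p.2 0} ∈ uniformity (ℤ → Bool) := by
    rw [Pi.uniformity]
    refine mem_iInf_of_mem 0 (mem_comap.2 ⟨{p | p.1 = p.2}, ?_, fun p hp => hp⟩)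
    exact DiscreteUniformity.relId_mem_uniformity Bool
  filter_upwards [h.2 _ hV] with y hy
  funext t
  have := hy t
  simp only [binaryShift_zpow_apply, zero_add] at this
  exact this.symm

theorem Preperfect.image_homeomorph {X : Type*} [TopologicalSpace X] {C : Set X}
    (hC : Preperfect C) (T : X ≃ₜ X) : Preperfect (T '' C) := by
  rintro _ ⟨x, hx, rfl⟩
  have := (hC x hx).map T.continuous.continuousAt T.injective
  rwa [map_principal] at this

/-- A closed invariant uncountable set of binary sequences is not hereditarily almost
equicontinuous. -/
theorem not_isHAE_of_not_countable {Y : Set (ℤ → Bool)} (hY : IsSubsystem binaryShift Y)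
    (hunc : ¬ Y.Countable) : ¬ IsHAE binaryShift Y := by
  intro hHAE
  obtain ⟨C, hC, hCne, hCY⟩ := exists_perfect_nonempty_of_isClosed_of_not_countable hY.2.1 hunc
  have hinv : ∀ n : ℤ, (binaryShift ^ n) '' Y ⊆ Y := fun n => by
    have h1 : ∀ y ∈ Y, binaryShift y ∈ Y := fun y hy => hY.2.2 ▸ Set.mem_image_of_mem _ hy
    have h2 : ∀ y ∈ Y, binaryShift⁻¹ y ∈ Y := fun y hy => by
      rw [← hY.2.2] at hy
      obtain ⟨z, hz, rfl⟩ := hy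
      convert hz
      exact binaryShift.symm_apply_apply z
    rintro _ ⟨y, hy, rfl⟩
    induction n using Int.induction_on generalizing y with
    | zero => simpa using hy
    | succ n ih =>
      rw [zpow_add_one, Homeomorph.mul_apply]
      exact ih _ (h1 y hy)
    | pred n ih =>
      rw [zpow_sub_one, Homeomorph.mul_apply]
      exact ih _ (h2 y hy)
  -- The shifts of a perfect set fill an invariant set without isolated points; its closure is a
  -- perfect subsystem.
  set Q : Set (ℤ → Bool) := ⋃ n : ℤ, (binaryShift ^ n) '' C with hQ
  have hQpre : Preperfect Q := by
    rintro x hx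
    obtain ⟨n, hn⟩ := Set.mem_iUnion.1 hx
    exact (hC.acc.image_homeomorph _ x hn).mono
      (principal_mono.2 (Set.subset_iUnion (fun n : ℤ => (binaryShift ^ n) '' C) n))
  have hperf := hQpre.perfect_closure
  have hQY : closure Q ⊆ Y := by
    refine closure_minimal (Set.iUnion_subset fun n => ?_) hY.2.1
    exact (Set.image_mono hCY).trans (hinv n)
  have hQne : (closure Q).Nonempty := by
    obtain ⟨x, hx⟩ := hCne
    exact ⟨x, subset_closure (Set.mem_iUnion.2 ⟨0, x, hx, by simp⟩)⟩
  have hsub : IsSubsystem binaryShift (closure Q) := by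
    refine ⟨hQne, isClosed_closure, ?_⟩
    rw [binaryShift.image_closure, hQ, image_iUnion_int_eq _ _ fun n => ?_]
    rw [Set.image_image, add_comm, zpow_one_add]
    rfl
  obtain ⟨x, hx⟩ := hQne
  obtain ⟨z, hz⟩ := closure_nonempty_iff.1 ⟨x, hHAE _ hQY hsub hx⟩
  have hacc := hperf.acc z hz.1
  rw [accPt_iff_frequently] at hacc
  refine hacc ?_
  filter_upwards [eventually_nhdsWithin_iff.1 hz.eventually_eq] with y hy h
  exact h.1 (hy h.2)

end

noncomputable section

/-! ### Labels of finite type with uncountable `Θ` -/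

theorem unitVec_le_add {p l l' : ℕ+} {v : NVec} (h : unitVec p + v ≤ unitVec l + unitVec l') :
    p = l ∨ p = l' := by
  by_contra! hne
  have := h p
  simp [unitVec, Finsupp.single_eq_of_ne hne.1, Finsupp.single_eq_of_ne hne.2] at this

theorem unitVec_le_add' {p l l' : ℕ+} {v : NVec} (h : v + unitVec p ≤ unitVec l + unitVec l') :
    p = l ∨ p = l' :=
  unitVec_le_add (add_comm v (unitVec p) ▸ h)

namespace NLabel

/-- The degree increases strictly along a strictly increasing sequence. -/
theorem isFiniteType_of_degree_le {M : NLabel} (B : ℕ)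
    (h : ∀ m ∈ M.carrier, Finsupp.degree m ≤ B) : M.IsFiniteType := by
  rintro ⟨f, hf, hM⟩
  have hdeg : StrictMono fun n => Finsupp.degree (f n) := fun a b hab => by
    have hlt := hf hab
    change Finsupp.degree (f a) < Finsupp.degree (f b)
    rw [← add_tsub_cancel_of_le hlt.le, map_add]
    refine Nat.lt_add_of_pos_right (Nat.pos_of_ne_zero fun h0 => ?_)
    rw [Finsupp.degree_eq_zero_iff, tsub_eq_zero_iff_le] at h0
    exact hlt.not_ge h0
  have h1 := hdeg.le_apply (x := B + 1)
  have h2 := h _ (hM (B + 1))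
  omega

theorem isFiniteType_generate {S : Set NVec} (B : ℕ) (h : ∀ v ∈ S, Finsupp.degree v ≤ B) :
    (generate S).IsFiniteType :=
  isFiniteType_of_degree_le B fun _ ⟨v, hv, hm⟩ => (Finsupp.degree_mono hm).trans (h v hv)

theorem not_countable_Theta {M : NLabel} {α : Type*} [Uncountable α] {g : α → NLabel}
    (hg : Function.Injective g) (h : ∀ a, g a ∈ M.Theta) : ¬ M.Theta.Countable := fun hc =>
  not_countable (α := α) (Set.countable_univ_iff.1
    (Set.MapsTo.countable_of_injOn (fun a _ => h a) hg.injOn hc))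

end NLabel

theorem uncountable_set (α : Type*) [Infinite α] : Uncountable (Set α) := ⟨fun _ => by
  obtain ⟨f, hf⟩ := exists_injective_nat (Set α)
  exact Function.cantor_injective _ ((Infinite.natEmbedding α).injective.comp hf)⟩

open Classical in
theorem uncountable_boolSeq : Uncountable (ℕ → Bool) := by
  have := uncountable_set ℕ
  refine Function.Injective.uncountable (f := fun (s : Set ℕ) n => decide (n ∈ s)) ?_
  intro s t h
  ext n
  simpa using congrFun h n

theorem isFiniteType_branchLabel (num : List Bool ≃ ℕ+) : (branchLabel num).IsFiniteType := by
  refine NLabel.isFiniteType_generate 2 ?_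
  rintro _ ⟨x, l, -, l', -, rfl⟩
  simp [unitVec]

theorem isFiniteType_finsetLabel (L : Set ℕ+) (num : Finset ℕ+ → ℕ+) :
    (finsetLabel L num).IsFiniteType := by
  refine NLabel.isFiniteType_generate 2 ?_
  rintro _ ⟨A, -, i, -, rfl⟩
  simp [unitVec]

/-- The limit of `M - χ(ℓ_w)` as `w` runs through the initial words of `y`. -/
def branchLimit (num : List Bool ≃ ℕ+) (y : ℕ → Bool) : NLabel :=
  (branchLabel num).subLimit (hyperfilter ℕ) fun n => unitVec (num ((List.range n).map y))

theorem eq_of_unitVec_mem_branchLimit {num : List Bool ≃ ℕ+} {y z : ℕ → Bool} {m : ℕ}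
    (h : unitVec (num ((List.range m).map z)) ∈ (branchLimit num y).carrier) :
    ∀ i < m, z i = y i := by
  have hge : ∀ᶠ n in hyperfilter ℕ, m ≤ n := Nat.hyperfilter_le_atTop (eventually_ge_atTop m)
  -- Both words are initial words of the same `x`; taking `n ≥ m` makes the word of `y` long enough
  -- to compare all `m` letters.
  obtain ⟨n, hn, hmn⟩ := (Eventually.and h hge).exists
  obtain ⟨_, ⟨x, l, ⟨a, -, rfl⟩, l', ⟨b, -, rfl⟩, rfl⟩, hle⟩ := hn
  have key : ∀ {k c : ℕ} {w : ℕ → Bool},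
      num ((List.range k).map w) = num ((List.range c).map x) → ∀ i < k, w i = x i := by
    intro k c w h i hi
    have h1 := num.injective h
    have h2 : k = c := by simpa using congrArg List.length h1
    subst h2
    exact List.map_inj_left.1 h1 i (List.mem_range.2 hi)
  intro i hi
  rw [(unitVec_le_add hle).elim key key i hi,
    (unitVec_le_add' hle).elim key key i (hi.trans_le hmn)]

theorem unitVec_mem_branchLimit (num : List Bool ≃ ℕ+) (y : ℕ → Bool) {m : ℕ} (hm : 0 < m) :
    unitVec (num ((List.range m).map y)) ∈ (branchLimit num y).carrier := by
  have hpos : ∀ᶠ n in hyperfilter ℕ, 0 < n := Nat.hyperfilter_le_atTop (eventually_gt_atTop 0)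
  exact hpos.mono fun n hn => ⟨_, ⟨y, _, ⟨m, hm, rfl⟩, _, ⟨n, hn, rfl⟩, rfl⟩, le_rfl⟩

theorem not_countable_Theta_branchLabel (num : List Bool ≃ ℕ+) :
    ¬ (branchLabel num).Theta.Countable := by
  have := uncountable_boolSeq
  refine NLabel.not_countable_Theta (g := branchLimit num) (fun y z h => funext fun i => ?_)
    fun y => NLabel.subLimit_mem_Theta _ _ _
  have := unitVec_mem_branchLimit num y i.succ_pos
  rw [h] at this
  exact eq_of_unitVec_mem_branchLimit this i i.lt_succ_self

open Classical in
/-- The limit of `M - χ(ℓ_A)` as `A` increases to `Y`. -/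
def finsetLimit (L : Set ℕ+) (num : Finset ℕ+ → ℕ+) (Y : Set ℕ+) : NLabel :=
  (finsetLabel L num).subLimit (hyperfilter ℕ) fun n =>
    unitVec (num ((Finset.Icc 1 n.succPNat).filter (· ∈ Y)))

theorem unitVec_mem_finsetLimit {L B : Set ℕ+} {num : Finset ℕ+ → ℕ+} (hLB : Disjoint L B)
    (hnum : Set.BijOn num {A | (A : Set ℕ+) ⊆ L} B) {Y : Set ℕ+} (hY : Y ⊆ L) {i : ℕ+}
    (hi : i ∈ L) : unitVec i ∈ (finsetLimit L num Y).carrier ↔ i ∈ Y := by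
  classical
  have hsub : ∀ n : ℕ, ((((Finset.Icc 1 n.succPNat).filter (· ∈ Y) : Finset ℕ+)) : Set ℕ+) ⊆ L :=
    fun n j hj => hY (Finset.mem_filter.1 (Finset.mem_coe.1 hj)).2
  constructor
  · intro h
    obtain ⟨n, _, ⟨A, hA, i', hi', rfl⟩, hle⟩ := Eventually.exists h
    -- Since `i ∈ L` and the labels `ℓ_A` lie in `B`, the two summands cannot be matched crosswise.
    have h1 : i = i' := (unitVec_le_add hle).resolve_left fun h =>
      Set.disjoint_left.1 hLB hi (h ▸ hnum.mapsTo hA)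
    have h2 := (unitVec_le_add' hle).resolve_right fun h =>
      Set.disjoint_left.1 hLB (hA hi') (h ▸ hnum.mapsTo (hsub n))
    have h3 := hnum.injOn (hsub n) hA h2
    subst h1
    rw [← h3] at hi'
    convert (Finset.mem_filter.1 hi').2
  · intro h
    have hge : ∀ᶠ n in hyperfilter ℕ, (i : ℕ) ≤ n :=
      Nat.hyperfilter_le_atTop (eventually_ge_atTop _)
    refine hge.mono fun n hn => ⟨_, ⟨_, hsub n, i, ?_, rfl⟩, ?_⟩
    · exact Finset.mem_filter.2 ⟨Finset.mem_Icc.2 ⟨one_le, (show (i : ℕ) ≤ n + 1 by omega)⟩, h⟩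
    · rw [add_comm]

theorem not_countable_Theta_finsetLabel {L B : Set ℕ+} {num : Finset ℕ+ → ℕ+} (hL : L.Infinite)
    (hLB : Disjoint L B) (hnum : Set.BijOn num {A | (A : Set ℕ+) ⊆ L} B) :
    ¬ (finsetLabel L num).Theta.Countable := by
  have : Infinite L := hL.to_subtype
  have := uncountable_set L
  refine NLabel.not_countable_Theta (α := Set L)
    (g := fun Y => finsetLimit L num (Subtype.val '' Y)) (fun Y Z h => Set.ext fun i => ?_)
    fun y => NLabel.subLimit_mem_Theta _ _ _
  have hmem := fun W : Set L =>
    unitVec_mem_finsetLimit hLB hnum (Subtype.coe_image_subset L W) i.2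
  have h' : finsetLimit L num (Subtype.val '' Y) = finsetLimit L num (Subtype.val '' Z) := h
  rw [← Subtype.val_injective.mem_set_image, ← hmem Y, h', hmem Z,
    Subtype.val_injective.mem_set_image]

end
theorem mainTheorem6 :
    (∀ num : List Bool ≃ ℕ+,
      (branchLabel num).IsFiniteType ∧ ¬ (branchLabel num).Theta.Countable) ∧
    (∀ (L B : Set ℕ+) (num : Finset ℕ+ → ℕ+), L.Infinite → B.Infinite → Disjoint L B →
      L ∪ B = Set.univ → Set.BijOn num {A | (A : Set ℕ+) ⊆ L} B →
      (finsetLabel L num).IsFiniteType ∧ ¬ (finsetLabel L num).Theta.Countable) ∧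
    (∀ (E : ExpansionSystem) (M : NLabel), M.IsFiniteType → ¬ M.Theta.Countable →
      IsSubsystem binaryShift (E.subshift M) ∧
      ¬ (E.subshift M).Countable ∧
      IsTopTransitive binaryShift (E.subshift M) ∧
      IsCenterTrivial binaryShift (E.subshift M) ∧
      (∀ x : ℤ → Bool,
        (x ∈ E.subshift M ∧ IsRecurrentPt binaryShift x) ↔ x = fun _ => false) ∧
      (∀ x ∈ E.subshift M, IsIsolatedIn (orbitClosure binaryShift x) x) ∧
      IsLE binaryShift (E.subshift M) ∧
      ¬ IsHAE binaryShift (E.subshift M)) := by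
  refine ⟨fun num => ⟨isFiniteType_branchLabel num, not_countable_Theta_branchLabel num⟩,
    fun L B num hL _ hLB _ hnum => ⟨isFiniteType_finsetLabel L num,
      not_countable_Theta_finsetLabel hL hLB hnum⟩, fun E M hM hunc => ?_⟩
  have hsub := isSubsystem_orbitClosure binaryShift (E.point M)
  have hrec := E.mem_subshift_and_isRecurrentPt_iff hM
  exact ⟨hsub, E.not_countable_subshift hunc, isTopTransitive_orbitClosure _ _,
    ⟨fun _ => false, (hrec _).2 rfl, fun x hx => (hrec x).1 hx⟩, hrec,
    fun _ hx => E.isIsolatedIn_orbitClosure hM hx,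
    fun _ hx => (E.isIsolatedIn_orbitClosure hM hx).isEquicontinuityPt,
    not_isHAE_of_not_countable hsub (E.not_countable_subshift hunc)⟩
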